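/- For integers $n$ and $2\le k\le n-2$, let $P=P_{n,k}$ be the following doubly stochastic transition matrix on $V=\{1,\dots,n\}$, which lives on the cycle $1,2,\dots,n,1$ with the extra edge $(k,n)$ added. For every vertex $v\notin\{k,n\}$, $$P(v,v)=P(v,v+1)=\tfrac12;$$ at the two hubs $k$ and $n$, $$P(k,k+1)=P(n,1)=\tfrac12,\qquad P(k,k)=P(k,n)=P(n,k)=P(n,n)=\tfrac14;$$ all other entries are $0$. Let $X(t)$ be the Markov chain with transition matrix $P$; its stationary distribution is uniform. Put $$d(t)=\max_{x\in V}\ \frac12\sum_{y\in V}\Bigl|P^t(x,y)-\frac1n\Bigr|,\qquad t_{\rm mix}(\varepsilon)=\min\{t\in\mathbb{N}: d(t)\le\varepsilon\},$$ so that $d(t)$ is the maximal total variation distance from the uniform distribution over all starting vertices. There exist constants $\gamma,\gamma'>0$ such that for every $0<\varepsilon<1/2$ the following holds for all $n$ large enough: if $k$ is chosen uniformly at random from the integers in $[2,n-2]$, then with probability at least $\gamma$ (over the choice of $k$) $$t_{\rm mix}(\varepsilon)\le\gamma'\,n^{3/2}\log\frac1\varepsilon .$$ -/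

import Mathlib

open Filter ProbabilityTheory
open scoped ENNReal

namespace DriftedCycle

/-- One-step probability of moving from the vertex labelled `x` to the vertex labelled `y`, with
labels in `{1, …, n}`. The arc `A` is `a_i = i` for `1 ≤ i ≤ k`, the arc `B` is `b_j = k + j` for
`1 ≤ j ≤ n - k`, and the hubs are `a_k = k` and `b_{n-k} = n`, joined by the added edge. -/
noncomputable def stepProb (n k x y : ℕ) : ℝ :=
  if x = k then
    if y = k + 1 then 1 / 2 else if y = k ∨ y = n then 1 / 4 else 0
  else if x = n then
    if y = 1 then 1 / 2 else if y = k ∨ y = n then 1 / 4 else 0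
  else
    if y = x + 1 ∨ y = x then 1 / 2 else 0

/-- The transition matrix of the chain. The element `v : Fin n` stands for the vertex with label
`v + 1`, so that the vertex set is `{1, …, n}`. -/
noncomputable def transitionMatrix (n k : ℕ) : Matrix (Fin n) (Fin n) ℝ :=
  Matrix.of fun x y => stepProb n k (x.val + 1) (y.val + 1)

/-- The transition matrix is doubly stochastic, so that the chain is well defined and the uniform
distribution is stationary. -/
theorem transitionMatrix_mem_doublyStochastic {n k : ℕ} (hk : 2 ≤ k) (hkn : k + 2 ≤ n) :
    transitionMatrix n k ∈ doublyStochastic ℝ (Fin n) := by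
  have hn : 0 < n := by omega
  rw [mem_doublyStochastic_iff_sum]
  refine ⟨fun x y => ?_, fun x => ?_, fun y => ?_⟩
  · simp only [transitionMatrix, Matrix.of_apply, stepProb]
    split_ifs <;> norm_num
  · have key : ∀ y : Fin n, transitionMatrix n k x y =
        if x.val + 1 = k then
          (if y = ⟨k, by omega⟩ then 1 / 2 else 0) +
          (if y = ⟨k - 1, by omega⟩ then 1 / 4 else 0) +
          (if y = ⟨n - 1, by omega⟩ then 1 / 4 else 0)
        else if x.val + 1 = n then
          (if y = ⟨0, by omega⟩ then 1 / 2 else 0) +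
          (if y = ⟨k - 1, by omega⟩ then 1 / 4 else 0) +
          (if y = ⟨n - 1, by omega⟩ then 1 / 4 else 0)
        else
          (if y = ⟨(x.val + 1) % n, Nat.mod_lt _ hn⟩ then 1 / 2 else 0) +
          (if y = x then 1 / 2 else 0) := by
      intro y
      have hx := x.isLt
      have hy := y.isLt
      simp only [transitionMatrix, Matrix.of_apply, stepProb, Fin.ext_iff]
      by_cases h : x.val + 1 = n
      · split_ifs <;> first | omega | norm_num
      · have h2 : (x.val + 1) % n = x.val + 1 := Nat.mod_eq_of_lt (by omega)
        rw [h2]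
        split_ifs <;> first | omega | norm_num
    simp only [key]
    split_ifs <;> simp [Finset.sum_add_distrib] <;> norm_num
  · have key : ∀ x : Fin n, transitionMatrix n k x y =
        if y.val + 1 = k ∨ y.val + 1 = n then
          (if x = ⟨y.val - 1, by omega⟩ then 1 / 2 else 0) +
          (if x = ⟨k - 1, by omega⟩ then 1 / 4 else 0) +
          (if x = ⟨n - 1, by omega⟩ then 1 / 4 else 0)
        else
          (if x = ⟨(y.val + (n - 1)) % n, Nat.mod_lt _ hn⟩ then 1 / 2 else 0) +
          (if x = y then 1 / 2 else 0) := by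
      intro x
      have hx := x.isLt
      have hy := y.isLt
      simp only [transitionMatrix, Matrix.of_apply, stepProb, Fin.ext_iff]
      by_cases h : y.val = 0
      · have h2 : (y.val + (n - 1)) % n = n - 1 := by
          rw [h, zero_add]; exact Nat.mod_eq_of_lt (by omega)
        rw [h2]
        split_ifs <;> first | omega | norm_num
      · have h2 : (y.val + (n - 1)) % n = y.val - 1 := by
          have : y.val + (n - 1) = (y.val - 1) + n := by omega
          rw [this, Nat.add_mod_right]; exact Nat.mod_eq_of_lt (by omega)
        rw [h2]
        split_ifs <;> first | omega | norm_num
    simp only [key]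
    split_ifs <;> simp [Finset.sum_add_distrib] <;> norm_num

/-- The total variation distance of two probability mass functions on a finite set. -/
noncomputable def tvDist {V : Type*} [Fintype V] (μ σ : V → ℝ) : ℝ :=
  (1 / 2) * ∑ x, |μ x - σ x|

/-- The law of `X(t)` for the chain started at the vertex `x`. -/
noncomputable def law (n k : ℕ) (x : Fin n) (t : ℕ) : Fin n → ℝ :=
  fun y => (transitionMatrix n k ^ t) x y

/-- The largest distance, over all starting vertices, of the law of `X(t)` from the uniform
distribution. -/
noncomputable def maxDist (n k t : ℕ) : ℝ :=
  ⨆ x : Fin n, tvDist (law n k x t) (fun _ => 1 / (n : ℝ))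

/-- The mixing time `min {t : d(t) ≤ ε}`, equal to `⊤` if there is no such `t`. -/
noncomputable def mixingTime (n k : ℕ) (ε : ℝ) : ℕ∞ :=
  ⨅ (t : ℕ) (_ : maxDist n k t ≤ ε), (t : ℕ∞)

end DriftedCycle

/-!
Why the chain mixes in time of order `n ^ (3 / 2)`. Let `δ_x` be the point mass at `x`, as a row
vector with the `ℓ¹` norm, and `P` the transition matrix. The proof shows that, for a suitable
time `T` of order `n ^ (3 / 2)`, all the laws `δ_x P ^ T` are within a small constant of each
other; then the distance to uniformity is halved every `T` steps. Everything is an estimate in the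
Banach algebra of matrices, and all smoothing comes from a single inequality
(`norm_avg_pow_mul_sub_le`): if `X` and `Y` are commuting contractions, then
`((X + Y) / 2) ^ m * (X - Y)` has norm at most `2 / √(m + 1)`. In essence this bounds the total
variation between a binomial distribution and its translate by one.

*Arcs are delays.* The matrix `P` is `1 / 4 + (3 / 4) K` with a contraction `K`, so that
`P ^ t (1 - P)` and `P ^ t (1 - P) ^ 2` have norm `O(t ^ (-1 / 2))` and `O(t ^ (-1))`. Off the hubs
`δ_(x + 1) = δ_x P ^ 2 - δ_x (1 - P) ^ 2`, so one step along an arc can be traded for a delay of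
two time units at the cost `O(1 / t)`, and an arc of length `d` for a delay of `2 d` at the cost
`O(d / t)` (`IsCycleSystem.norm_arc_le`). At the end of an arc the chain enters the other arc with
probability `3 / 4` and the same arc again with probability `1 / 4`, up to `O(t ^ (-1 / 2))`
(`IsCycleSystem.norm_hub_le`).

*Renewals.* With `u = P ^ (2 k)`, `w = P ^ (2 (n - k))`, and `a`, `b` the laws at time `t` of the
chains started at the first vertices of the two arcs, this says `a u ≈ a / 4 + 3 b / 4` and
`b w ≈ b / 4 + 3 a / 4`. Eliminating `b` gives `a u w ≈ a q` with `q = 1 / 2 + (u + w) / 4`, whence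
`a (u w) ^ N ≈ a q ^ N`. The operator `q` is an average of two contractions in two ways, and the
smoothing inequality shows that `q ^ N` nearly absorbs `u` and `w`, with error `O(N ^ (-1 / 2))`.
For `N` of order `√n` the law thus hardly changes under `O(n ^ (1 / 4))` further delays by `2 k` or
`2 n`, while laziness makes it insensitive to delays `O(n ^ (3 / 4))`
(`IsCycleSystem.norm_delay_le`).

*Diophantine part.* These delays combine to every even delay up to `2 n` as soon as the multiples
`J k` with `J ≤ L`, where `L` is about `n ^ (1 / 4)`, are dense modulo `n` at scale `n / L`. By
Dirichlet's theorem this holds unless `k / n` is within order `1 / (q L)` of a fraction with a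
denominator `q < L / 16` (`IsBadlyApproximable.exists_near_multiple`), and at least half of the `k`
have this property (`half_le_card_isBadlyApproximable`). All laws `δ_x P ^ T` are then close to the
law started at the vertex `1` (`IsCycleSystem.norm_sub_le_of_delay`).
-/

namespace DriftedCycle

/-! ### Contractions -/

section Contraction

variable {R : Type*} [NormedRing R]

theorem norm_mul_le_of_le_one {X Y : R} {c : ℝ} (hX : ‖X‖ ≤ c) (hY : ‖Y‖ ≤ 1) : ‖X * Y‖ ≤ c :=
  (norm_mul_le X Y).trans <| (mul_le_of_le_one_right (norm_nonneg _) hY).trans hX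

theorem norm_mul_le_of_le_one' {X Y : R} {c : ℝ} (hX : ‖X‖ ≤ 1) (hY : ‖Y‖ ≤ c) : ‖X * Y‖ ≤ c :=
  (norm_mul_le X Y).trans <| (mul_le_of_le_one_left (norm_nonneg _) hX).trans hY

theorem norm_pow_le_one [NormOneClass R] {X : R} (h : ‖X‖ ≤ 1) (m : ℕ) : ‖X ^ m‖ ≤ 1 :=
  (norm_pow_le X m).trans (pow_le_one₀ (norm_nonneg _) h)

end Contraction

/-! ### Smoothing by averages of commuting contractions -/

section Smoothing

variable {R : Type*} [NormedRing R] [NormedAlgebra ℝ R]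

theorem norm_avg_le_one {X Y : R} (hX : ‖X‖ ≤ 1) (hY : ‖Y‖ ≤ 1) :
    ‖(1 / 2 : ℝ) • (X + Y)‖ ≤ 1 := by
  rw [norm_smul, Real.norm_of_nonneg (by norm_num)]
  have := norm_add_le X Y
  linarith

/-- The variance of the binomial distribution with parameter `1 / 2`, without normalization. -/
theorem sum_choose_mul_sq (M : ℕ) :
    ∑ i ∈ Finset.range (M + 1), (M.choose i : ℝ) * (2 * (i : ℝ) - M) ^ 2 = (2 : ℝ) ^ M * M := by
  have h := congrArg (Polynomial.eval (1 / 2 : ℝ)) (bernsteinPolynomial.variance ℝ M)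
  simp only [Polynomial.eval_finsetSum, bernsteinPolynomial, Polynomial.eval_mul,
    Polynomial.eval_pow, Polynomial.eval_sub, Polynomial.eval_natCast, Polynomial.eval_X,
    Polynomial.eval_one, nsmul_eq_mul] at h
  have h2 : ∑ i ∈ Finset.range (M + 1), (M.choose i : ℝ) * (2 * (i : ℝ) - M) ^ 2 =
      4 * 2 ^ M * ((M : ℝ) * (1 / 2) * (1 - 1 / 2)) := by
    rw [← h, Finset.mul_sum]
    refine Finset.sum_congr rfl fun i hi => ?_
    have hi' : i ≤ M := by simpa [Nat.lt_succ_iff] using hi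
    have hp : (1 / 2 : ℝ) ^ i * (1 - 1 / 2) ^ (M - i) = (1 / 2) ^ M := by
      norm_num only [sub_self]
      rw [← pow_add, Nat.add_sub_cancel' hi']
    have h2 : (2 : ℝ) ^ M * (1 / 2) ^ M = 1 := by rw [← mul_pow]; norm_num
    calc (M.choose i : ℝ) * (2 * (i : ℝ) - M) ^ 2
        = 4 * ((M : ℝ) * (1 / 2) - i) ^ 2 * M.choose i * (2 ^ M * (1 / 2) ^ M) := by
          rw [h2]; ring
      _ = 4 * 2 ^ M * (((M : ℝ) * (1 / 2) - i) ^ 2 *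
            ((M.choose i : ℝ) * (1 / 2) ^ i * (1 - 1 / 2) ^ (M - i))) := by rw [← hp]; ring
  rw [h2]; ring

/-- The mean absolute deviation of a binomial distribution is at most its standard deviation. -/
theorem sum_choose_mul_abs_le (M : ℕ) (hM : 0 < M) :
    ∑ i ∈ Finset.range (M + 1), (M.choose i : ℝ) * |2 * (i : ℝ) - M| ≤ 2 ^ M * √M := by
  have hs : 0 < √(M : ℝ) := Real.sqrt_pos.2 (by exact_mod_cast hM)
  have hss : √(M : ℝ) * √(M : ℝ) = M := Real.mul_self_sqrt (by positivity)
  have hb : ∑ i ∈ Finset.range (M + 1), (M.choose i : ℝ) = 2 ^ M := by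
    exact_mod_cast Nat.sum_range_choose M
  have key : ∀ i ∈ Finset.range (M + 1), (M.choose i : ℝ) * |2 * (i : ℝ) - M| ≤
      (M.choose i : ℝ) * (2 * i - M) ^ 2 * (1 / (2 * √M)) + M.choose i * (√M / 2) := by
    intro i _
    have h1 : |2 * (i : ℝ) - M| ≤ (2 * (i : ℝ) - M) ^ 2 * (1 / (2 * √M)) + √M / 2 := by
      rw [← sq_abs (2 * (i : ℝ) - M)]
      set d := |2 * (i : ℝ) - M|
      have : d ^ 2 * (1 / (2 * √M)) + √M / 2 - d = (d - √M) ^ 2 / (2 * √M) := by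
        field_simp; ring
      have h0 : 0 ≤ (d - √M) ^ 2 / (2 * √M) := by positivity
      linarith
    calc _ ≤ (M.choose i : ℝ) * ((2 * (i : ℝ) - M) ^ 2 * (1 / (2 * √M)) + √M / 2) := by gcongr
      _ = _ := by ring
  refine (Finset.sum_le_sum key).trans (le_of_eq ?_)
  rw [Finset.sum_add_distrib, ← Finset.sum_mul, ← Finset.sum_mul, sum_choose_mul_sq, hb]
  field_simp
  rw [Real.sq_sqrt (by positivity)]
  ring

/-- The coefficients are differences of consecutive binomial coefficients, written so that the
sum of their absolute values is a mean absolute deviation. -/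
theorem add_pow_mul_sub {X Y : R} (h : Commute X Y) (m : ℕ) :
    ((m + 1 : ℕ) : ℝ) • ((X + Y) ^ m * (X - Y)) =
      ∑ i ∈ Finset.range (m + 1 + 1),
        (((m + 1).choose i : ℝ) * (2 * i - (m + 1 : ℕ))) • (X ^ i * Y ^ (m + 1 - i)) := by
  have hX : ((m + 1 : ℕ) : ℝ) • ((X + Y) ^ m * X) = ∑ i ∈ Finset.range (m + 1 + 1),
      (((m + 1).choose i : ℝ) * i) • (X ^ i * Y ^ (m + 1 - i)) := by
    rw [Finset.sum_range_succ', h.add_pow, Finset.sum_mul, Finset.smul_sum]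
    simp only [Nat.cast_zero, mul_zero, zero_smul, add_zero]
    refine Finset.sum_congr rfl fun i _ => ?_
    have hc : (((m + 1).choose (i + 1) : ℝ) * (i + 1 : ℕ)) = ((m + 1 : ℕ) : ℝ) * m.choose i := by
      exact_mod_cast (Nat.add_one_mul_choose_eq m i).symm
    rw [hc, Nat.add_sub_add_right, mul_smul, pow_succ, mul_assoc (X ^ i) X,
      (h.pow_right (m - i)).eq, ← mul_assoc, ← nsmul_eq_mul', ← Nat.cast_smul_eq_nsmul ℝ,
      smul_mul_assoc]
  have hY : ((m + 1 : ℕ) : ℝ) • ((X + Y) ^ m * Y) = ∑ i ∈ Finset.range (m + 1 + 1),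
      (((m + 1).choose i : ℝ) * ((m + 1 : ℕ) - i)) • (X ^ i * Y ^ (m + 1 - i)) := by
    rw [Finset.sum_range_succ, h.add_pow, Finset.sum_mul, Finset.smul_sum]
    simp only [sub_self, mul_zero, zero_smul, add_zero]
    refine Finset.sum_congr rfl fun i hi => ?_
    have hi' : i ≤ m := by simpa [Nat.lt_succ_iff] using hi
    have hc : (((m + 1).choose i : ℝ) * ((m + 1 : ℕ) - i)) = ((m + 1 : ℕ) : ℝ) * m.choose i := by
      rw [← Nat.cast_sub (by omega)]
      have := Nat.choose_mul_succ_eq m i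
      rw [mul_comm] at this
      exact_mod_cast this.symm
    rw [hc, mul_smul, Nat.succ_sub hi', pow_succ, ← mul_assoc (X ^ i), ← nsmul_eq_mul',
      ← Nat.cast_smul_eq_nsmul ℝ, smul_mul_assoc]
  rw [mul_sub, smul_sub, hX, hY, ← Finset.sum_sub_distrib]
  refine Finset.sum_congr rfl fun i _ => ?_
  rw [← sub_smul]
  congr 1
  ring

variable [NormOneClass R]

/-- The smoothing inequality on which all decay estimates rest. -/
theorem norm_avg_pow_mul_sub_le {X Y : R} (h : Commute X Y) (hX : ‖X‖ ≤ 1) (hY : ‖Y‖ ≤ 1)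
    (m : ℕ) : ‖((1 / 2 : ℝ) • (X + Y)) ^ m * (X - Y)‖ ≤ 2 / √((m : ℝ) + 1) := by
  have hM : (0 : ℝ) < ((m + 1 : ℕ) : ℝ) := by positivity
  have hs : 0 < √((m + 1 : ℕ) : ℝ) := Real.sqrt_pos.2 hM
  have h1 : ‖((m + 1 : ℕ) : ℝ) • ((X + Y) ^ m * (X - Y))‖ ≤ 2 ^ (m + 1) * √((m + 1 : ℕ) : ℝ) := by
    rw [add_pow_mul_sub h]
    refine (norm_sum_le _ _).trans (le_trans (Finset.sum_le_sum fun i _ => ?_)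
      (sum_choose_mul_abs_le (m + 1) (Nat.succ_pos m)))
    rw [norm_smul, Real.norm_eq_abs, abs_mul, Nat.abs_cast]
    exact mul_le_of_le_one_right (by positivity)
      (norm_mul_le_of_le_one (norm_pow_le_one hX _) (norm_pow_le_one hY _))
  rw [norm_smul, Real.norm_of_nonneg hM.le] at h1
  rw [smul_pow, smul_mul_assoc, norm_smul, Real.norm_of_nonneg (by positivity),
    show (m : ℝ) + 1 = ((m + 1 : ℕ) : ℝ) by push_cast; rfl, le_div_iff₀ hs]
  have hss : √((m + 1 : ℕ) : ℝ) * √((m + 1 : ℕ) : ℝ) = ((m + 1 : ℕ) : ℝ) :=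
    Real.mul_self_sqrt hM.le
  have h2 : ‖(X + Y) ^ m * (X - Y)‖ * √((m + 1 : ℕ) : ℝ) ≤ 2 ^ (m + 1) := by
    refine le_of_mul_le_mul_right ?_ hs
    calc _ = ((m + 1 : ℕ) : ℝ) * ‖(X + Y) ^ m * (X - Y)‖ := by rw [mul_assoc, hss, mul_comm]
      _ ≤ _ := h1
  calc (1 / 2 : ℝ) ^ m * ‖(X + Y) ^ m * (X - Y)‖ * √((m + 1 : ℕ) : ℝ)
      ≤ (1 / 2 : ℝ) ^ m * 2 ^ (m + 1) := by rw [mul_assoc]; gcongr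
    _ = 2 := by rw [pow_succ, ← mul_assoc, ← mul_pow]; norm_num

/-- `P` is a lazy contraction: the average of the identity and a contraction with weights `1/4`
and `3/4`. -/
def IsLazy (P : R) : Prop :=
  ∃ K : R, ‖K‖ ≤ 1 ∧ P = (1 / 4 : ℝ) • (1 : R) + (3 / 4 : ℝ) • K

theorem IsLazy.norm_le_one {P : R} (hP : IsLazy P) : ‖P‖ ≤ 1 := by
  obtain ⟨K, hK, rfl⟩ := hP
  refine (norm_add_le _ _).trans ?_
  rw [norm_smul, norm_smul, norm_one, Real.norm_of_nonneg (by norm_num),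
    Real.norm_of_nonneg (by norm_num)]
  linarith

theorem IsLazy.norm_pow_mul_le {P : R} (hP : IsLazy P) (m : ℕ) :
    ‖P ^ m * (1 - P)‖ ≤ 3 / √((m : ℝ) + 1) := by
  obtain ⟨K, hK, rfl⟩ := hP
  have hc : Commute ((1 / 2 : ℝ) • ((1 : R) + K)) K :=
    (((Commute.one_left K).add_left (Commute.refl K))).smul_left _
  have h := norm_avg_pow_mul_sub_le hc (norm_avg_le_one norm_one.le hK) hK m
  have e1 : (1 / 2 : ℝ) • ((1 / 2 : ℝ) • ((1 : R) + K) + K) =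
      (1 / 4 : ℝ) • (1 : R) + (3 / 4 : ℝ) • K := by module
  have e2 : 1 - ((1 / 4 : ℝ) • (1 : R) + (3 / 4 : ℝ) • K) =
      (3 / 2 : ℝ) • ((1 / 2 : ℝ) • ((1 : R) + K) - K) := by module
  rw [e1] at h
  rw [e2, mul_smul_comm, norm_smul, Real.norm_of_nonneg (by norm_num)]
  calc _ ≤ 3 / 2 * (2 / √((m : ℝ) + 1)) := by gcongr
    _ = _ := by ring

/-- Second differences in time decay at the square of the rate of first differences. -/
theorem IsLazy.norm_pow_mul_sq_le {P : R} (hP : IsLazy P) (m : ℕ) :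
    ‖P ^ (2 * m) * (1 - P) ^ 2‖ ≤ 9 / ((m : ℝ) + 1) := by
  have hc : Commute (1 - P) (P ^ m) := ((Commute.one_left P).sub_left (Commute.refl P)).pow_right m
  have h := hP.norm_pow_mul_le m
  have e : P ^ (2 * m) * (1 - P) ^ 2 = P ^ m * (1 - P) * (P ^ m * (1 - P)) := by
    rw [two_mul, pow_add, sq, mul_assoc (P ^ m) (1 - P), ← mul_assoc (1 - P), hc.eq]
    simp only [mul_assoc]
  rw [e]
  refine (norm_mul_le _ _).trans ((mul_le_mul h h (norm_nonneg _) (by positivity)).trans ?_)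
  rw [div_mul_div_comm, Real.mul_self_sqrt (by positivity)]
  norm_num

end Smoothing

/-! ### Renewals of the passage through the arcs -/

section Renewal

variable {R : Type*} [NormedRing R]

theorem norm_mul_one_sub_pow_le [NormOneClass R] {q x : R} {c : ℝ} (hx : ‖x‖ ≤ 1)
    (h : ‖q * (1 - x)‖ ≤ c) (J : ℕ) : ‖q * (1 - x ^ J)‖ ≤ J * c := by
  induction J with
  | zero => simp
  | succ J ih =>
    have e : q * (1 - x ^ (J + 1)) = q * (1 - x ^ J) + q * (1 - x) * x ^ J := by
      rw [pow_succ']; noncomm_ring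
    rw [e]
    refine (norm_add_le _ _).trans ?_
    have := norm_mul_le_of_le_one h (norm_pow_le_one hx J)
    push_cast
    linarith

variable [NormedAlgebra ℝ R]

/-- The operator `1 / 2 + (u + w) / 4` by which a delay `u * w` by the full cycle can be replaced,
where `u` and `w` are the delays by the two arcs. Its three terms correspond to a renewal after the
full cycle, after the second arc, and after the first arc. It is written as an average of two
contractions whose difference is `(u - w) / 2`. -/
noncomputable def renewalOp (u w : R) : R :=
  (1 / 2 : ℝ) • ((1 / 2 : ℝ) • (1 + u) + (1 / 2 : ℝ) • (1 + w))

variable {u w : R}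

theorem Commute.renewalOp_left {x : R} (hu : Commute u x) (hw : Commute w x) :
    Commute (renewalOp u w) x :=
  (((((Commute.one_left x).add_left hu).smul_left _).add_left
    (((Commute.one_left x).add_left hw).smul_left _))).smul_left _

theorem renewalOp_comm (u w : R) : renewalOp u w = renewalOp w u := by
  unfold renewalOp; rw [add_comm]

variable {a b : R} {e : ℝ}

/-- Elimination of `b` from the two approximate passage relations. -/
theorem norm_mul_mul_sub_renewalOp_le (hw : ‖w‖ ≤ 1)
    (ha : ‖a * u - ((1 / 4 : ℝ) • a + (3 / 4 : ℝ) • b)‖ ≤ e)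
    (hb : ‖b * w - ((1 / 4 : ℝ) • b + (3 / 4 : ℝ) • a)‖ ≤ e) :
    ‖a * (u * w) - a * renewalOp u w‖ ≤ 2 * e := by
  set r := a * u - ((1 / 4 : ℝ) • a + (3 / 4 : ℝ) • b) with hr
  set s := b * w - ((1 / 4 : ℝ) • b + (3 / 4 : ℝ) • a) with hs
  -- `(a * u - a / 4) * (w - 1 / 4)` is evaluated with the first relation, then with the second
  have key : a * (u * w) - a * renewalOp u w = r * w - (1 / 4 : ℝ) • r + (3 / 4 : ℝ) • s := by
    simp only [hr, hs, renewalOp, mul_add, sub_mul, add_mul, mul_smul_comm, smul_mul_assoc,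
      mul_assoc, mul_one]
    module
  rw [key]
  refine (norm_add_le _ _).trans ?_
  have h1 := norm_sub_le (r * w) ((1 / 4 : ℝ) • r)
  have h2 := norm_mul_le_of_le_one ha hw
  rw [norm_smul, Real.norm_of_nonneg (by norm_num)] at h1
  rw [norm_smul, Real.norm_of_nonneg (by norm_num)]
  linarith

variable [NormOneClass R]

theorem norm_renewalOp_le_one (hu : ‖u‖ ≤ 1) (hw : ‖w‖ ≤ 1) : ‖renewalOp u w‖ ≤ 1 :=
  norm_avg_le_one (norm_avg_le_one norm_one.le hu) (norm_avg_le_one norm_one.le hw)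

theorem norm_renewalOp_pow_mul_sub_le (huw : Commute u w) (hu : ‖u‖ ≤ 1) (hw : ‖w‖ ≤ 1) (N : ℕ) :
    ‖renewalOp u w ^ N * (u - w)‖ ≤ 4 / √((N : ℝ) + 1) := by
  have hc : Commute ((1 / 2 : ℝ) • (1 + u)) ((1 / 2 : ℝ) • (1 + w)) :=
    (((((Commute.one_left 1).add_left (Commute.one_right u)).add_right
      ((Commute.one_left w).add_left huw))).smul_left _).smul_right _
  have h := norm_avg_pow_mul_sub_le hc (norm_avg_le_one norm_one.le hu)
    (norm_avg_le_one norm_one.le hw) N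
  have e : u - w = (2 : ℝ) • ((1 / 2 : ℝ) • (1 + u) - (1 / 2 : ℝ) • (1 + w)) := by module
  rw [e, mul_smul_comm, norm_smul, Real.norm_of_nonneg (by norm_num)]
  calc _ ≤ 2 * (2 / √((N : ℝ) + 1)) := by gcongr; exact h
    _ = _ := by ring

/-- Here `renewalOp u w` is used as the average of `1` and `(u + w) / 2`. -/
theorem norm_renewalOp_pow_mul_one_sub_avg_le (hu : ‖u‖ ≤ 1) (hw : ‖w‖ ≤ 1)
    (N : ℕ) : ‖renewalOp u w ^ N * (1 - (1 / 2 : ℝ) • (u + w))‖ ≤ 2 / √((N : ℝ) + 1) := by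
  have h := norm_avg_pow_mul_sub_le (Commute.one_left ((1 / 2 : ℝ) • (u + w))) norm_one.le
    (norm_avg_le_one hu hw) N
  have e : renewalOp u w = (1 / 2 : ℝ) • (1 + (1 / 2 : ℝ) • (u + w)) := by
    unfold renewalOp; module
  rwa [e]

theorem norm_renewalOp_pow_mul_one_sub_left_le (huw : Commute u w) (hu : ‖u‖ ≤ 1) (hw : ‖w‖ ≤ 1)
    (N : ℕ) : ‖renewalOp u w ^ N * (1 - u)‖ ≤ 4 / √((N : ℝ) + 1) := by
  have h1 := norm_renewalOp_pow_mul_sub_le huw hu hw N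
  have h2 := norm_renewalOp_pow_mul_one_sub_avg_le hu hw N
  have e : 1 - u = (1 - (1 / 2 : ℝ) • (u + w)) - (1 / 2 : ℝ) • (u - w) := by module
  rw [e, mul_sub, mul_smul_comm]
  refine (norm_sub_le _ _).trans ?_
  rw [norm_smul, Real.norm_of_nonneg (by norm_num)]
  calc _ ≤ 2 / √((N : ℝ) + 1) + 1 / 2 * (4 / √((N : ℝ) + 1)) := by gcongr
    _ = _ := by ring

theorem norm_renewalOp_pow_mul_one_sub_mul_le (huw : Commute u w) (hu : ‖u‖ ≤ 1) (hw : ‖w‖ ≤ 1)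
    (N : ℕ) : ‖renewalOp u w ^ N * (1 - u * w)‖ ≤ 8 / √((N : ℝ) + 1) := by
  have h1 := norm_renewalOp_pow_mul_one_sub_left_le huw hu hw N
  have h2 := norm_renewalOp_pow_mul_one_sub_left_le huw.symm hw hu N
  rw [renewalOp_comm] at h2
  have e : renewalOp u w ^ N * (1 - u * w) =
      renewalOp u w ^ N * (1 - u) * w + renewalOp u w ^ N * (1 - w) := by noncomm_ring
  rw [e]
  refine (norm_add_le _ _).trans ?_
  calc _ ≤ 4 / √((N : ℝ) + 1) + 4 / √((N : ℝ) + 1) := by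
        gcongr
        exact norm_mul_le_of_le_one h1 hw
    _ = _ := by ring

theorem norm_mul_pow_sub_renewalOp_pow_le (huw : Commute u w) (hu : ‖u‖ ≤ 1) (hw : ‖w‖ ≤ 1)
    (ha : ‖a * u - ((1 / 4 : ℝ) • a + (3 / 4 : ℝ) • b)‖ ≤ e)
    (hb : ‖b * w - ((1 / 4 : ℝ) • b + (3 / 4 : ℝ) • a)‖ ≤ e) (N : ℕ) :
    ‖a * (u * w) ^ N - a * renewalOp u w ^ N‖ ≤ 2 * e * N := by
  have h1 := norm_mul_mul_sub_renewalOp_le hw ha hb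
  have hq := norm_renewalOp_le_one hu hw
  have huw1 : ‖u * w‖ ≤ 1 := norm_mul_le_of_le_one hu hw
  have hc : Commute (renewalOp u w) (u * w) :=
    Commute.renewalOp_left ((Commute.refl u).mul_right huw) (huw.symm.mul_right (Commute.refl w))
  induction N with
  | zero => simp
  | succ N ih =>
    have key : a * (u * w) ^ (N + 1) - a * renewalOp u w ^ (N + 1) =
        (a * (u * w) - a * renewalOp u w) * (u * w) ^ N +
        (a * (u * w) ^ N - a * renewalOp u w ^ N) * renewalOp u w := by
      rw [sub_mul, sub_mul, mul_assoc a (renewalOp u w), (hc.pow_right N).eq, pow_succ' (u * w),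
        pow_succ]
      simp only [mul_assoc]
      abel
    rw [key]
    refine (norm_add_le _ _).trans ?_
    have h2 := norm_mul_le_of_le_one h1 (norm_pow_le_one huw1 N)
    have h3 := norm_mul_le_of_le_one ih hq
    push_cast
    linarith

/-- The error `4 * e * N` of the comparison of `(u * w) ^ N` with `renewalOp u w ^ N` does not grow
with `J`: the comparison is made once, not for each factor `x`. -/
theorem norm_mul_pow_mul_one_sub_pow_le (huw : Commute u w) (hu : ‖u‖ ≤ 1) (hw : ‖w‖ ≤ 1)
    (ha1 : ‖a‖ ≤ 1)
    (ha : ‖a * u - ((1 / 4 : ℝ) • a + (3 / 4 : ℝ) • b)‖ ≤ e)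
    (hb : ‖b * w - ((1 / 4 : ℝ) • b + (3 / 4 : ℝ) • a)‖ ≤ e) {N : ℕ} {x : R} {c : ℝ}
    (hx : ‖x‖ ≤ 1) (hc : ‖renewalOp u w ^ N * (1 - x)‖ ≤ c) (J : ℕ) :
    ‖a * (u * w) ^ N * (1 - x ^ J)‖ ≤ 4 * e * N + J * c := by
  have h1 := norm_mul_pow_sub_renewalOp_pow_le huw hu hw ha hb N
  have h2 := norm_mul_one_sub_pow_le hx hc J
  have key : a * (u * w) ^ N * (1 - x ^ J) =
      (a * (u * w) ^ N - a * renewalOp u w ^ N) * (1 - x ^ J) +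
      a * (renewalOp u w ^ N * (1 - x ^ J)) := by noncomm_ring
  rw [key]
  refine (norm_add_le _ _).trans ?_
  have h3 : ‖1 - x ^ J‖ ≤ 2 := by
    refine (norm_sub_le _ _).trans ?_
    have := norm_pow_le_one hx J
    rw [norm_one]; linarith
  have h4 : ‖(a * (u * w) ^ N - a * renewalOp u w ^ N) * (1 - x ^ J)‖ ≤ 2 * e * N * 2 :=
    (norm_mul_le _ _).trans (mul_le_mul h1 h3 (norm_nonneg _) ((norm_nonneg _).trans h1))
  have h5 := norm_mul_le_of_le_one' ha1 h2
  linarith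

end Renewal

/-! ### The cycle with two hubs -/

section Cycle

variable {R : Type*} [NormedRing R] [NormedAlgebra ℝ R] [NormOneClass R]

/-- Changing the time by at most `s` steps costs at most `s` first differences. -/
theorem IsLazy.norm_pow_sub_pow_le {P : R} (hP : IsLazy P) (t : ℕ) {i j s : ℕ}
    (hij : i ≤ j + s) (hji : j ≤ i + s) :
    ‖P ^ t * (P ^ i - P ^ j)‖ ≤ s * (3 / √((t : ℝ) + 1)) := by
  have key : ∀ i j : ℕ, i ≤ j → j ≤ i + s →
      ‖P ^ t * (P ^ i - P ^ j)‖ ≤ s * (3 / √((t : ℝ) + 1)) := by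
    intro i j hij hji
    obtain ⟨d, rfl⟩ := Nat.exists_eq_add_of_le hij
    have h := norm_mul_one_sub_pow_le hP.norm_le_one (hP.norm_pow_mul_le t) d
    have e : P ^ t * (P ^ i - P ^ (i + d)) = P ^ t * (1 - P ^ d) * P ^ i := by
      rw [add_comm i d, pow_add]; noncomm_ring
    rw [e]
    refine (norm_mul_le_of_le_one h (norm_pow_le_one hP.norm_le_one i)).trans ?_
    have : d ≤ s := by omega
    gcongr
  rcases le_total i j with h | h
  · exact key i j h hji
  · rw [← neg_sub, mul_neg, norm_neg]
    exact key j i h hij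

/-- An abstract form of the drifted cycle: `φ x` plays the role of the point mass at the vertex
`x`, and right multiplication by `P` is one step of the chain. -/
structure IsCycleSystem (P : R) (φ : ℕ → R) (n k : ℕ) : Prop where
  one_le : 1 ≤ k
  lt : k < n
  isLazy : IsLazy P
  norm_le (x : ℕ) : ‖φ x‖ ≤ 1
  arc (x : ℕ) : 1 ≤ x → x < n → x ≠ k → φ x * P = (1 / 2 : ℝ) • φ x + (1 / 2 : ℝ) • φ (x + 1)
  hub_left : φ k * P = (1 / 2 : ℝ) • φ (k + 1) + (1 / 4 : ℝ) • φ k + (1 / 4 : ℝ) • φ n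
  hub_right : φ n * P = (1 / 2 : ℝ) • φ 1 + (1 / 4 : ℝ) • φ n + (1 / 4 : ℝ) • φ k

namespace IsCycleSystem

variable {P : R} {φ : ℕ → R} {n k : ℕ}

/-- Advancing by `d` vertices within an arc amounts to a delay of `2 * d`, up to `d` second
differences in time. -/
theorem norm_arc_le (h : IsCycleSystem P φ n k) (m : ℕ) {x : ℕ} (hx : 1 ≤ x) (d : ℕ)
    (hd : ∀ i < d, x + i < n ∧ x + i ≠ k) :
    ‖φ (x + d) * P ^ (2 * m) - φ x * P ^ (2 * m) * P ^ (2 * d)‖ ≤ d * (9 / ((m : ℝ) + 1)) := by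
  induction d with
  | zero => simp
  | succ d ih =>
    have ih' := ih fun i hi => hd i (hi.trans d.lt_succ_self)
    have hs := h.arc (x + d) (by omega) (hd d d.lt_succ_self).1 (hd d d.lt_succ_self).2
    -- `(1 - P) ^ 2` is the error in replacing `2 * P - 1`, which moves one vertex on, by `P ^ 2`
    have hnext : φ (x + (d + 1)) = φ (x + d) * P ^ 2 - φ (x + d) * (1 - P) ^ 2 := by
      have e : φ (x + d) * P ^ 2 - φ (x + d) * (1 - P) ^ 2 =
          (2 : ℝ) • (φ (x + d) * P) - φ (x + d) := by
        rw [two_smul]; noncomm_ring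
      rw [e, hs, ← add_assoc]
      module
    have hc : P ^ 2 * P ^ (2 * m) = P ^ (2 * m) * P ^ 2 := (Commute.pow_pow_self P 2 (2 * m)).eq
    have hc' : (1 - P) ^ 2 * P ^ (2 * m) = P ^ (2 * m) * (1 - P) ^ 2 :=
      (((Commute.one_left P).sub_left (Commute.refl P)).pow_pow 2 (2 * m)).eq
    have key : φ (x + (d + 1)) * P ^ (2 * m) - φ x * P ^ (2 * m) * P ^ (2 * (d + 1)) =
        (φ (x + d) * P ^ (2 * m) - φ x * P ^ (2 * m) * P ^ (2 * d)) * P ^ 2 -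
          φ (x + d) * (P ^ (2 * m) * (1 - P) ^ 2) := by
      rw [hnext, sub_mul, mul_assoc, hc, mul_assoc (φ (x + d)), hc', Nat.mul_succ, pow_add P (2 * d)]
      noncomm_ring
    rw [key]
    refine (norm_sub_le _ _).trans ?_
    have h1 := norm_mul_le_of_le_one ih' (norm_pow_le_one h.isLazy.norm_le_one 2)
    have h2 := norm_mul_le_of_le_one' (h.norm_le (x + d)) (h.isLazy.norm_pow_mul_sq_le m)
    push_cast
    linarith

/-- At a hub `p`, joined by the added edge to the hub `q`, the chain continues to the successor `p'`
of `p` with probability `3 / 4` and to the successor `q'` of `q` with probability `1 / 4`; only the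
duration of the stay at the hubs contributes to the error. -/
theorem norm_hub_le {p q p' q' : R} (hP : IsLazy P) (hp1 : ‖p‖ ≤ 1) (hq1 : ‖q‖ ≤ 1)
    (hp : p * P = (1 / 2 : ℝ) • p' + (1 / 4 : ℝ) • p + (1 / 4 : ℝ) • q)
    (hq : q * P = (1 / 2 : ℝ) • q' + (1 / 4 : ℝ) • q + (1 / 4 : ℝ) • p) (t : ℕ) :
    ‖p * P ^ t - ((1 / 4 : ℝ) • (q' * P ^ t) + (3 / 4 : ℝ) • (p' * P ^ t))‖ ≤
      2 * (3 / √((t : ℝ) + 1)) := by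
  have e : p - ((1 / 4 : ℝ) • q' + (3 / 4 : ℝ) • p') =
      (1 / 2 : ℝ) • (q * (1 - P)) + (3 / 2 : ℝ) • (p * (1 - P)) := by
    rw [mul_sub, mul_sub, hp, hq, mul_one, mul_one]
    module
  have hc : (1 - P) * P ^ t = P ^ t * (1 - P) :=
    (((Commute.one_left P).sub_left (Commute.refl P)).pow_right t).eq
  have key : p * P ^ t - ((1 / 4 : ℝ) • (q' * P ^ t) + (3 / 4 : ℝ) • (p' * P ^ t)) =
      (1 / 2 : ℝ) • (q * (P ^ t * (1 - P))) + (3 / 2 : ℝ) • (p * (P ^ t * (1 - P))) := by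
    calc _ = (p - ((1 / 4 : ℝ) • q' + (3 / 4 : ℝ) • p')) * P ^ t := by
          simp only [sub_mul, add_mul, smul_mul_assoc]
      _ = _ := by rw [e, add_mul, smul_mul_assoc, smul_mul_assoc, mul_assoc, mul_assoc, hc]
  rw [key]
  refine (norm_add_le _ _).trans ?_
  rw [norm_smul, norm_smul, Real.norm_of_nonneg (by norm_num), Real.norm_of_nonneg (by norm_num)]
  have h1 := norm_mul_le_of_le_one' hp1 (hP.norm_pow_mul_le t)
  have h2 := norm_mul_le_of_le_one' hq1 (hP.norm_pow_mul_le t)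
  linarith

/-- Bound for the error made when the passage through an arc and the hub at its end is replaced
by a deterministic delay of twice the length of the arc. -/
noncomputable def passageError (n m : ℕ) : ℝ :=
  n * (9 / ((m : ℝ) + 1)) + 4 * (3 / √(((2 * m : ℕ) : ℝ) + 1))

theorem norm_passage_le (h : IsCycleSystem P φ n k) (m : ℕ) {x d : ℕ} (hx : 1 ≤ x)
    (hd : ∀ i < d, x + i < n ∧ x + i ≠ k) (hdn : d < n) {r : R}
    (hr : ‖φ (x + d) * P ^ (2 * m) - r‖ ≤ 2 * (3 / √(((2 * m : ℕ) : ℝ) + 1))) :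
    ‖φ x * P ^ (2 * m) * P ^ (2 * (d + 1)) - r‖ ≤ passageError n m := by
  have h1 := norm_mul_le_of_le_one (h.norm_arc_le m hx d hd)
    (norm_pow_le_one h.isLazy.norm_le_one 2)
  have h2 : ‖φ (x + d) * (P ^ (2 * m) * (P ^ 2 - P ^ 0))‖ ≤ 2 * (3 / √(((2 * m : ℕ) : ℝ) + 1)) :=
    norm_mul_le_of_le_one' (h.norm_le _)
      (by exact_mod_cast h.isLazy.norm_pow_sub_pow_le (2 * m) (s := 2) (i := 2) (j := 0)
            (by omega) (by omega))
  have key : φ x * P ^ (2 * m) * P ^ (2 * (d + 1)) - r =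
      -((φ (x + d) * P ^ (2 * m) - φ x * P ^ (2 * m) * P ^ (2 * d)) * P ^ 2) +
      φ (x + d) * (P ^ (2 * m) * (P ^ 2 - P ^ 0)) + (φ (x + d) * P ^ (2 * m) - r) := by
    rw [Nat.mul_succ, pow_add P (2 * d), pow_zero]
    noncomm_ring
  rw [key]
  refine (norm_add₃_le).trans ?_
  rw [norm_neg]
  have h3 : (d : ℝ) * (9 / ((m : ℝ) + 1)) ≤ n * (9 / ((m : ℝ) + 1)) := by gcongr
  unfold passageError
  linarith

theorem norm_passage_left_le (h : IsCycleSystem P φ n k) (m : ℕ) :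
    ‖φ 1 * P ^ (2 * m) * P ^ (2 * k) -
      ((1 / 4 : ℝ) • (φ 1 * P ^ (2 * m)) + (3 / 4 : ℝ) • (φ (k + 1) * P ^ (2 * m)))‖ ≤
      passageError n m := by
  have hk := h.one_le
  have hkn := h.lt
  have h1 := h.norm_passage_le m le_rfl (d := k - 1)
    (r := (1 / 4 : ℝ) • (φ 1 * P ^ (2 * m)) + (3 / 4 : ℝ) • (φ (k + 1) * P ^ (2 * m)))
    (fun i hi => by omega) (by omega)
  rw [show 1 + (k - 1) = k by omega, show k - 1 + 1 = k by omega] at h1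
  exact h1 (norm_hub_le h.isLazy (h.norm_le _) (h.norm_le _) h.hub_left h.hub_right _)

theorem norm_passage_right_le (h : IsCycleSystem P φ n k) (m : ℕ) :
    ‖φ (k + 1) * P ^ (2 * m) * P ^ (2 * (n - k)) -
      ((1 / 4 : ℝ) • (φ (k + 1) * P ^ (2 * m)) + (3 / 4 : ℝ) • (φ 1 * P ^ (2 * m)))‖ ≤
      passageError n m := by
  have hkn := h.lt
  have hk := h.one_le
  have h1 := h.norm_passage_le m (show 1 ≤ k + 1 by omega) (d := n - k - 1)
    (r := (1 / 4 : ℝ) • (φ (k + 1) * P ^ (2 * m)) + (3 / 4 : ℝ) • (φ 1 * P ^ (2 * m)))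
    (fun i hi => by omega) (by omega)
  rw [show k + 1 + (n - k - 1) = n by omega, show n - k - 1 + 1 = n - k by omega] at h1
  exact h1 (norm_hub_le h.isLazy (h.norm_le _) (h.norm_le _) h.hub_right h.hub_left _)

/-- Bound for the effect on the law at time `2 * m + 2 * n * N` of an even delay, when each delay
is reached, up to `s` steps, with at most `J` additional passages through the arc `A` and at most
`l` turns of the cycle. -/
noncomputable def delayError (n m N J l s : ℕ) : ℝ :=
  2 * s * (3 / √(((2 * m : ℕ) : ℝ) + 1)) + 8 * passageError n m * N +
    (4 * J + 8 * l) / √((N : ℝ) + 1)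

/-- A delay of `2 * D` is absorbed if, up to `s`, the number `D` and some multiple of `k` add up to a
multiple of `n`: both the delays by `2 * k` and the delays by `2 * n` are nearly invisible. -/
theorem norm_delay_le (h : IsCycleSystem P φ n k) (m N : ℕ) {J l s D J' l' : ℕ}
    (hJ : J' ≤ J) (hl : l' ≤ l) (h1 : D + J' * k ≤ l' * n + s) (h2 : l' * n ≤ D + J' * k + s) :
    ‖φ 1 * P ^ (2 * m + 2 * n * N) * (P ^ (2 * D) - 1)‖ ≤ delayError n m N J l s := by
  have hkn := h.lt
  have hP := h.isLazy.norm_le_one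
  have hu := norm_pow_le_one hP (2 * k)
  have hw := norm_pow_le_one hP (2 * (n - k))
  have huw : Commute (P ^ (2 * k)) (P ^ (2 * (n - k))) := Commute.pow_pow_self P _ _
  have hz : P ^ (2 * k) * P ^ (2 * (n - k)) = P ^ (2 * n) := by
    rw [← pow_add]; congr 1; omega
  have ha1 : ‖φ 1 * P ^ (2 * m)‖ ≤ 1 := norm_mul_le_of_le_one (h.norm_le 1) (norm_pow_le_one hP _)
  have eu := norm_mul_pow_mul_one_sub_pow_le huw hu hw ha1 (h.norm_passage_left_le m)
    (h.norm_passage_right_le m) hu (norm_renewalOp_pow_mul_one_sub_left_le huw hu hw N) J'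
  have ez := norm_mul_pow_mul_one_sub_pow_le huw hu hw ha1 (h.norm_passage_left_le m)
    (h.norm_passage_right_le m) (norm_mul_le_of_le_one hu hw)
    (norm_renewalOp_pow_mul_one_sub_mul_le huw hu hw N) l'
  have es : ‖φ 1 * (P ^ (2 * m) * (P ^ (2 * (D + J' * k)) - P ^ (2 * (l' * n))))‖ ≤
      ((2 * s : ℕ) : ℝ) * (3 / √(((2 * m : ℕ) : ℝ) + 1)) :=
    norm_mul_le_of_le_one' (h.norm_le 1)
      (h.isLazy.norm_pow_sub_pow_le (2 * m) (by omega) (by omega))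
  rw [hz] at eu ez
  have e1 := norm_mul_le_of_le_one eu (norm_pow_le_one hP (2 * D))
  have e2 := norm_mul_le_of_le_one es (norm_pow_le_one hP (2 * n * N))
  have key : φ 1 * P ^ (2 * m + 2 * n * N) * (P ^ (2 * D) - 1) =
      φ 1 * P ^ (2 * m) * (P ^ (2 * n)) ^ N * (1 - (P ^ (2 * k)) ^ J') * P ^ (2 * D) +
      φ 1 * (P ^ (2 * m) * (P ^ (2 * (D + J' * k)) - P ^ (2 * (l' * n)))) * P ^ (2 * n * N) -
      φ 1 * P ^ (2 * m) * (P ^ (2 * n)) ^ N * (1 - (P ^ (2 * n)) ^ l') := by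
    simp only [← pow_mul, mul_sub, sub_mul, mul_assoc, mul_one, ← pow_add]
    rw [show 2 * m + 2 * (n * N) + 2 * (k * J') + 2 * D =
        2 * m + 2 * (D + J' * k) + 2 * (n * N) by ring,
      show 2 * m + 2 * (n * N) + 2 * (n * l') = 2 * m + 2 * (l' * n) + 2 * (n * N) by ring]
    abel
  rw [key]
  refine (norm_sub_le _ _).trans ((add_le_add_left (norm_add_le _ _) _).trans ?_)
  have c1 : (J' : ℝ) * (4 / √((N : ℝ) + 1)) ≤ J * (4 / √((N : ℝ) + 1)) := by gcongr
  have c2 : (l' : ℝ) * (8 / √((N : ℝ) + 1)) ≤ l * (8 / √((N : ℝ) + 1)) := by gcongr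
  have c3 : (4 * (J : ℝ) + 8 * l) / √((N : ℝ) + 1) =
      J * (4 / √((N : ℝ) + 1)) + l * (8 / √((N : ℝ) + 1)) := by ring
  unfold delayError
  push_cast at e2 ⊢
  linarith

/-- If all even delays up to `2 * n` are absorbed, then the starting vertex is forgotten: every
vertex is reached from the first vertex of its arc by a delay, and the first vertex of the second
arc is recovered from the passage through the first. -/
theorem norm_sub_le_of_delay (h : IsCycleSystem P φ n k) (m N : ℕ) {J l s : ℕ}
    (hd : ∀ D ≤ n, ∃ J' ≤ J, ∃ l' ≤ l, D + J' * k ≤ l' * n + s ∧ l' * n ≤ D + J' * k + s)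
    {x : ℕ} (hx : 1 ≤ x) (hxn : x ≤ n) :
    ‖φ x * P ^ (2 * m + 2 * n * N) - φ 1 * P ^ (2 * m + 2 * n * N)‖ ≤
      3 * (delayError n m N J l s + passageError n m) := by
  have hkn := h.lt
  have hk := h.one_le
  have hP := h.isLazy.norm_le_one
  have hdel : ∀ D ≤ n, ‖φ 1 * P ^ (2 * m + 2 * n * N) * (P ^ (2 * D) - 1)‖ ≤
      delayError n m N J l s := by
    intro D hD
    obtain ⟨J', hJ, l', hl, h1, h2⟩ := hd D hD
    exact h.norm_delay_le m N hJ hl h1 h2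
  have harc : ∀ y d, 1 ≤ y → (∀ i < d, y + i < n ∧ y + i ≠ k) → d ≤ n →
      ‖φ (y + d) * P ^ (2 * m + 2 * n * N) - φ y * P ^ (2 * m + 2 * n * N) * P ^ (2 * d)‖ ≤
        passageError n m := by
    intro y d hy hyd hdn
    have h1 := norm_mul_le_of_le_one (h.norm_arc_le m hy d hyd) (norm_pow_le_one hP (2 * n * N))
    have e : φ (y + d) * P ^ (2 * m + 2 * n * N) - φ y * P ^ (2 * m + 2 * n * N) * P ^ (2 * d) =
        (φ (y + d) * P ^ (2 * m) - φ y * P ^ (2 * m) * P ^ (2 * d)) * P ^ (2 * n * N) := by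
      simp only [sub_mul, mul_assoc, ← pow_add]
      rw [add_right_comm]
    rw [e]
    refine h1.trans ?_
    have h3 : (d : ℝ) * (9 / ((m : ℝ) + 1)) ≤ n * (9 / ((m : ℝ) + 1)) := by gcongr
    have h4 : 0 ≤ 4 * (3 / √(((2 * m : ℕ) : ℝ) + 1)) := by positivity
    unfold passageError
    linarith
  have he0 : 0 ≤ passageError n m := by unfold passageError; positivity
  have hE0 : 0 ≤ delayError n m N J l s := (norm_nonneg _).trans (hdel 0 (Nat.zero_le n))
  set T := 2 * m + 2 * n * N with hT
  rcases le_or_gt x k with hxk | hxk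
  · have h1 := harc 1 (x - 1) le_rfl (fun i hi => by omega) (by omega)
    have h2 := hdel (x - 1) (by omega)
    rw [show 1 + (x - 1) = x by omega] at h1
    have e : φ x * P ^ T - φ 1 * P ^ T =
        (φ x * P ^ T - φ 1 * P ^ T * P ^ (2 * (x - 1))) +
          φ 1 * P ^ T * (P ^ (2 * (x - 1)) - 1) := by noncomm_ring
    rw [e]
    refine (norm_add_le _ _).trans ?_
    linarith
  · have h1 := harc (k + 1) (x - k - 1) (by omega) (fun i hi => by omega) (by omega)
    have h2 := hdel (x - k - 1) (by omega)
    have h3 := hdel k (by omega)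
    rw [show k + 1 + (x - k - 1) = x by omega] at h1
    have h4 : ‖φ (k + 1) * P ^ T - φ 1 * P ^ T‖ ≤
        4 / 3 * (delayError n m N J l s + passageError n m) := by
      have h5 := norm_mul_le_of_le_one (h.norm_passage_left_le m)
        (norm_pow_le_one hP (2 * n * N))
      have hc : P ^ (2 * k) * P ^ (2 * (n * N)) = P ^ (2 * (n * N)) * P ^ (2 * k) :=
        (Commute.pow_pow_self P _ _).eq
      have e : φ (k + 1) * P ^ T - φ 1 * P ^ T = (4 / 3 : ℝ) • (φ 1 * P ^ T * (P ^ (2 * k) - 1) -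
          (φ 1 * P ^ (2 * m) * P ^ (2 * k) - ((1 / 4 : ℝ) • (φ 1 * P ^ (2 * m)) +
            (3 / 4 : ℝ) • (φ (k + 1) * P ^ (2 * m)))) * P ^ (2 * n * N)) := by
        rw [hT, pow_add]
        simp only [sub_mul, add_mul, mul_sub, mul_assoc, smul_mul_assoc, hc, mul_one]
        module
      rw [e, norm_smul, Real.norm_of_nonneg (by norm_num)]
      have := norm_sub_le (φ 1 * P ^ T * (P ^ (2 * k) - 1))
        ((φ 1 * P ^ (2 * m) * P ^ (2 * k) - ((1 / 4 : ℝ) • (φ 1 * P ^ (2 * m)) +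
            (3 / 4 : ℝ) • (φ (k + 1) * P ^ (2 * m)))) * P ^ (2 * n * N))
      linarith
    have h6 := norm_mul_le_of_le_one h4 (norm_pow_le_one hP (2 * (x - k - 1)))
    have e : φ x * P ^ T - φ 1 * P ^ T =
        (φ x * P ^ T - φ (k + 1) * P ^ T * P ^ (2 * (x - k - 1))) +
        (φ (k + 1) * P ^ T - φ 1 * P ^ T) * P ^ (2 * (x - k - 1)) +
        φ 1 * P ^ T * (P ^ (2 * (x - k - 1)) - 1) := by noncomm_ring
    rw [e]
    refine norm_add₃_le.trans ?_
    linarith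

end IsCycleSystem

end Cycle

/-! ### Multiples of `k` modulo `n` -/

section Diophantine

/-- The number `k / n` is badly approximable by fractions with denominator below `L / 16`. -/
def IsBadlyApproximable (n k L : ℕ) : Prop :=
  ∀ q : ℕ, 1 ≤ q → 16 * q < L → ∀ p : ℤ, (n : ℤ) < L * |(q : ℤ) * k - p * n|

/-- A fraction `p / q` in lowest terms with `q ≤ L` and `k / n ≈ p / q`, as given by Dirichlet's
theorem, has `q ≥ L / 16`. The residues `J * k` with `J < q` are then close to all multiples of
`n / q` modulo `n`. -/
theorem IsBadlyApproximable.exists_near_multiple {n k L s : ℕ} (hk : k ≤ n) (hn : 0 < n)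
    (hL : 0 < L) (h : IsBadlyApproximable n k L) (hs : 17 * n ≤ L * s) {D : ℕ} (hD : D ≤ n) :
    ∃ J ≤ L, ∃ l ≤ L + 1, D + J * k ≤ l * n + s ∧ l * n ≤ D + J * k + s := by
  obtain ⟨r, hr, hrL⟩ := Real.exists_rat_abs_sub_le_and_den_le ((k : ℝ) / n) hL
  obtain ⟨q, hq⟩ : ∃ q : ℕ, q = r.den := ⟨_, rfl⟩
  obtain ⟨p, hp⟩ : ∃ p : ℤ, p = r.num := ⟨_, rfl⟩
  have hq0 : 0 < q := hq ▸ r.den_pos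
  have hcop : IsCoprime p (q : ℤ) := by
    rw [hq, hp, Int.isCoprime_iff_gcd_eq_one]
    exact r.reduced
  rw [← hq] at hr hrL
  have happ : ((L : ℤ) + 1) * |(q : ℤ) * k - p * n| ≤ n := by
    have hn' : (0 : ℝ) < n := by exact_mod_cast hn
    have hq' : (0 : ℝ) < q := by exact_mod_cast hq0
    have e : (k : ℝ) / n - r = ((q : ℝ) * k - p * n) / (q * n) := by
      have : (r : ℝ) = p / q := by rw [hp, hq]; exact_mod_cast (Rat.num_div_den r).symm
      rw [this]; field_simp
    rw [e, abs_div, abs_of_pos (mul_pos hq' hn'), div_le_div_iff₀ (by positivity) (by positivity),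
      one_mul] at hr
    have : ((L : ℝ) + 1) * |(q : ℝ) * k - p * n| ≤ n := by
      refine le_of_mul_le_mul_left ?_ hq'
      linarith
    exact_mod_cast this
  have hLq : L ≤ 16 * q := by
    by_contra hlt
    have := h q hq0 (not_le.1 hlt) p
    have := abs_nonneg ((q : ℤ) * k - p * n)
    linarith
  have hLa : (L : ℤ) * |(q : ℤ) * k - p * n| ≤ n := by
    have := abs_nonneg ((q : ℤ) * k - p * n)
    linarith
  have hn' : (0 : ℤ) < n := by exact_mod_cast hn
  have hq' : (0 : ℤ) < q := by exact_mod_cast hq0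
  have hL' : (0 : ℤ) < L := by exact_mod_cast hL
  have hk' : (k : ℤ) ≤ n := by exact_mod_cast hk
  have habs : |(q : ℤ) * k - p * n| < n := by
    have := abs_nonneg ((q : ℤ) * k - p * n)
    nlinarith
  rw [abs_lt] at habs
  have hp0 : 0 ≤ p := by
    by_contra hneg
    have h1 : p ≤ -1 := by omega
    nlinarith [mul_nonneg hq'.le (Int.natCast_nonneg k)]
  have hpq : p ≤ q := by
    by_contra hneg
    have h1 : (q : ℤ) + 1 ≤ p := by omega
    nlinarith
  -- `c / q` is the fraction with denominator `q` just below `D / n`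
  obtain ⟨c, hc⟩ : ∃ c : ℤ, c = (q : ℤ) * D / n := ⟨_, rfl⟩
  have hc1 : c * n ≤ q * D := by rw [hc]; exact Int.ediv_mul_le _ hn'.ne'
  have hc2 : q * D < (c + 1) * n := by rw [hc]; exact Int.lt_ediv_add_one_mul_self _ hn'
  have hD' : (D : ℤ) ≤ n := by exact_mod_cast hD
  have hc0 : 0 ≤ c := by rw [hc]; positivity
  have hcq : c ≤ q := by nlinarith
  obtain ⟨a, b, hab⟩ := hcop
  -- `J` solves `J * p + c = 0` modulo `q`
  obtain ⟨J, hJ⟩ : ∃ J : ℤ, J = (-c * a) % q := ⟨_, rfl⟩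
  have hJ0 : 0 ≤ J := by rw [hJ]; exact Int.emod_nonneg _ hq'.ne'
  have hJq : J < q := by rw [hJ]; exact Int.emod_lt_of_pos _ hq'
  obtain ⟨l, hl⟩ : ∃ l : ℤ, J * p + c = l * q := by
    refine ⟨c * b - (-c * a) / q * p, ?_⟩
    have h1 := Int.emod_add_mul_ediv (-c * a) q
    rw [← hJ] at h1
    linear_combination p * h1 - c * hab
  have hl0 : 0 ≤ l := by
    have : 0 ≤ l * q := by rw [← hl]; positivity
    exact nonneg_of_mul_nonneg_left this hq'
  have hlq : l ≤ q + 1 := by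
    have h1 : l * q ≤ (q + 1) * q := by rw [← hl]; nlinarith
    exact le_of_mul_le_mul_right h1 hq'
  have herr : (L : ℤ) * |(D : ℤ) + J * k - l * n| ≤ L * s := by
    have e : (q : ℤ) * ((D : ℤ) + J * k - l * n) = (q * D - c * n) + J * (q * k - p * n) := by
      linear_combination (n : ℤ) * hl
    have h1 : (q : ℤ) * |(D : ℤ) + J * k - l * n| ≤ n + J * |(q : ℤ) * k - p * n| := by
      rw [← abs_of_pos hq', ← abs_mul, abs_of_pos hq', e]
      refine (abs_add_le _ _).trans ?_
      rw [abs_mul, abs_of_nonneg hJ0, abs_of_nonneg (by linarith : (0 : ℤ) ≤ q * D - c * n)]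
      linarith
    have h2 : (q : ℤ) * (L * |(D : ℤ) + J * k - l * n|) ≤ q * (17 * n) := by
      have h3 : J * (L * |(q : ℤ) * k - p * n|) ≤ q * n :=
        mul_le_mul hJq.le hLa (by positivity) hq'.le
      have h4 : (L : ℤ) * n ≤ 16 * q * n := by
        have : (L : ℤ) ≤ 16 * q := by exact_mod_cast hLq
        gcongr
      have h5 := mul_le_mul_of_nonneg_left h1 hL'.le
      linarith
    have h6 : (17 : ℤ) * n ≤ L * s := by exact_mod_cast hs
    exact (le_of_mul_le_mul_left h2 hq').trans h6
  have herr' := abs_le.1 (le_of_mul_le_mul_left herr hL')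
  lift J to ℕ using hJ0
  lift l to ℕ using hl0
  refine ⟨J, by omega, l, by omega, ?_, ?_⟩
  · zify; linarith
  · zify; linarith

/-- The numbers `k` with `k / n` close to a given fraction lie in an interval. -/
theorem card_filter_near_fraction_le (n q L : ℕ) (hq : 0 < q) (hL : 0 < L) (p : ℤ)
    (S : Finset ℕ) :
    (S.filter fun k : ℕ => (L : ℤ) * |(q : ℤ) * k - p * n| ≤ n).card ≤ 2 * n / (L * q) + 1 := by
  set F := S.filter fun k : ℕ => (L : ℤ) * |(q : ℤ) * k - p * n| ≤ n with hF
  rcases F.eq_empty_or_nonempty with h0 | hne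
  · simp [h0]
  · have hsub : F ⊆ Finset.Icc (F.min' hne) (F.min' hne + 2 * n / (L * q)) := by
      intro k hk
      have hle := F.min'_le k hk
      have hm := F.min'_mem hne
      generalize F.min' hne = k₀ at hle hm
      obtain ⟨d, rfl⟩ := Nat.exists_eq_add_of_le hle
      rw [Finset.mem_Icc]
      refine ⟨hle, Nat.add_le_add_left ?_ _⟩
      rw [Nat.le_div_iff_mul_le (by positivity)]
      have h1 := (Finset.mem_filter.1 hk).2
      have h2 := (Finset.mem_filter.1 hm).2
      have h3 := abs_sub ((q : ℤ) * (k₀ + d : ℕ) - p * n) ((q : ℤ) * k₀ - p * n)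
      have e : (q : ℤ) * (k₀ + d : ℕ) - p * n - ((q : ℤ) * k₀ - p * n) = q * d := by
        push_cast; ring
      rw [e, abs_of_nonneg (by positivity)] at h3
      have hL' : (0 : ℤ) ≤ L := by positivity
      have h4 := mul_le_mul_of_nonneg_left h3 hL'
      zify
      linarith
    refine (Finset.card_le_card hsub).trans ?_
    rw [Nat.card_Icc]
    generalize 2 * n / (L * q) = z
    omega

open Classical in
/-- Union bound over the fractions with denominator at most `L / 16`: those with denominator `q`
number `q + 1` and exclude about `2 * n / (L * q)` values of `k` each. -/
theorem card_not_isBadlyApproximable_le (n L : ℕ) (hn : 0 < n) (hL : 0 < L) :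
    128 * ((Finset.Icc 2 (n - 2)).filter fun k => ¬ IsBadlyApproximable n k L).card ≤
      32 * n + L ^ 2 := by
  set Q := L / 16 with hQ
  have hQL : 16 * Q ≤ L := Nat.mul_div_le L 16
  have hsub : ((Finset.Icc 2 (n - 2)).filter fun k => ¬ IsBadlyApproximable n k L) ⊆
      (Finset.Icc 1 Q).biUnion fun q => (Finset.range (q + 1)).biUnion fun p =>
        (Finset.Icc 2 (n - 2)).filter fun k : ℕ =>
          (L : ℤ) * |(q : ℤ) * k - ((p : ℕ) : ℤ) * n| ≤ n := by
    intro k hk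
    obtain ⟨hk1, hk2⟩ := Finset.mem_filter.1 hk
    unfold IsBadlyApproximable at hk2
    push Not at hk2
    obtain ⟨q, hq1, hqL, p, hp⟩ := hk2
    have hn' : (0 : ℤ) < n := by exact_mod_cast hn
    have hL' : (2 : ℤ) ≤ L := by omega
    have hkn : (k : ℤ) ≤ n := by
      have := (Finset.mem_Icc.1 hk1).2
      omega
    have hq' : (0 : ℤ) < q := by omega
    have habs : |(q : ℤ) * k - p * n| < n := by
      have := abs_nonneg ((q : ℤ) * k - p * n)
      nlinarith
    rw [abs_lt] at habs
    have hp0 : 0 ≤ p := by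
      by_contra hneg
      have h1 : p ≤ -1 := by omega
      nlinarith [mul_nonneg hq'.le (Int.natCast_nonneg k)]
    have hpq : p ≤ q := by
      by_contra hneg
      have h1 : (q : ℤ) + 1 ≤ p := by omega
      nlinarith
    lift p to ℕ using hp0
    simp only [Finset.mem_biUnion]
    refine ⟨q, Finset.mem_Icc.2 ⟨hq1, by omega⟩, p, Finset.mem_range.2 (by omega), ?_⟩
    exact Finset.mem_filter.2 ⟨hk1, hp⟩
  have hcard : ((Finset.Icc 2 (n - 2)).filter fun k => ¬ IsBadlyApproximable n k L).card ≤
      ∑ q ∈ Finset.Icc 1 Q, (q + 1) * (2 * n / (L * q) + 1) := by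
    refine (Finset.card_le_card hsub).trans (Finset.card_biUnion_le.trans ?_)
    refine Finset.sum_le_sum fun q hq => Finset.card_biUnion_le.trans ?_
    have hq0 : 0 < q := (Finset.mem_Icc.1 hq).1
    refine (Finset.sum_le_sum fun (p : ℕ) _ =>
      card_filter_near_fraction_le n q L hq0 hL (p : ℤ) _).trans ?_
    rw [Finset.sum_const, Finset.card_range, smul_eq_mul]
  have hterm : ∀ q ∈ Finset.Icc 1 Q,
      L * ((q + 1) * (2 * n / (L * q) + 1)) ≤ 4 * n + 2 * Q * L := by
    intro q hq
    obtain ⟨hq1, hqQ⟩ := Finset.mem_Icc.1 hq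
    have h1 : L * q * (2 * n / (L * q)) ≤ 2 * n := Nat.mul_div_le _ _
    generalize 2 * n / (L * q) = z at h1
    have h2 : L * ((q + 1) * (z + 1)) ≤ L * ((2 * q) * (z + 1)) := by gcongr; omega
    have h3 : L * (2 * q) ≤ 2 * Q * L := by rw [mul_comm]; gcongr
    nlinarith
  have hsum := Finset.sum_le_sum hterm
  rw [← Finset.mul_sum, Finset.sum_const, Nat.card_Icc, smul_eq_mul, Nat.add_sub_cancel] at hsum
  have h1 := (Nat.mul_le_mul_left L hcard).trans hsum
  refine Nat.le_of_mul_le_mul_left (c := L) ?_ hL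
  generalize ((Finset.Icc 2 (n - 2)).filter fun k => ¬ IsBadlyApproximable n k L).card = B at h1
  calc L * (128 * B) = 128 * (L * B) := by ring
    _ ≤ 128 * (Q * (4 * n + 2 * Q * L)) := by gcongr
    _ = (16 * Q) * (32 * n + (16 * Q) * L) := by ring
    _ ≤ L * (32 * n + L * L) := by gcongr
    _ = _ := by ring

open Classical in
/-- At least half of the choices of `k` are favourable. -/
theorem half_le_card_isBadlyApproximable {n L : ℕ} (hn : 16 ≤ n) (hL : 0 < L) (hLn : L ^ 2 ≤ n) :
    n ≤ 2 * ((Finset.Icc 2 (n - 2)).filter fun k => IsBadlyApproximable n k L).card := by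
  have h1 := card_not_isBadlyApproximable_le n L (by omega) hL
  have h2 := Finset.card_filter_add_card_filter_not (s := Finset.Icc 2 (n - 2))
    (fun k => IsBadlyApproximable n k L)
  rw [Nat.card_Icc] at h2
  omega

end Diophantine

/-! ### The transition matrix -/

section Matrix

attribute [local instance] Matrix.linftyOpNormedRing Matrix.linftyOpNormedAlgebra
  Matrix.linftyOpNormedAddCommGroup

theorem sum_abs_le_linfty_opNorm {n : ℕ} (A : Matrix (Fin n) (Fin n) ℝ) (i : Fin n) :
    ∑ j, |A i j| ≤ ‖A‖ := by
  rw [Matrix.linfty_opNorm_def]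
  have h := Finset.le_sup (f := fun i => ∑ j, ‖A i j‖₊) (Finset.mem_univ i)
  have h2 : ((∑ j, ‖A i j‖₊ : NNReal) : ℝ) = ∑ j, |A i j| := by
    rw [NNReal.coe_sum]; rfl
  rw [← h2]
  exact_mod_cast h

theorem linfty_opNorm_le {n : ℕ} {A : Matrix (Fin n) (Fin n) ℝ} {c : ℝ} (hc : 0 ≤ c)
    (h : ∀ i, ∑ j, |A i j| ≤ c) : ‖A‖ ≤ c := by
  rw [Matrix.linfty_opNorm_def]
  lift c to NNReal using hc
  rw [NNReal.coe_le_coe]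
  refine Finset.sup_le fun i _ => ?_
  rw [← NNReal.coe_le_coe, NNReal.coe_sum]
  exact h i

/-- The point mass at the vertex labelled `x`, as a matrix with equal rows, so that its operator
norm on the sup norm is the `ℓ¹` norm of a row. It vanishes if no vertex has the label `x`. -/
noncomputable def pointMass (n x : ℕ) : Matrix (Fin n) (Fin n) ℝ :=
  Matrix.of fun _ y => if y.val + 1 = x then 1 else 0

theorem norm_pointMass_le (n x : ℕ) : ‖pointMass n x‖ ≤ 1 := by
  refine linfty_opNorm_le zero_le_one fun i => ?_
  simp only [pointMass, Matrix.of_apply, apply_ite abs, abs_one, abs_zero]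
  rw [Finset.sum_ite, Finset.sum_const_zero, add_zero, Finset.sum_const, nsmul_eq_mul, mul_one]
  have : (Finset.univ.filter fun y : Fin n => y.val + 1 = x).card ≤ 1 := by
    refine Finset.card_le_one.2 fun a ha b hb => ?_
    have ha' := (Finset.mem_filter.1 ha).2
    have hb' := (Finset.mem_filter.1 hb).2
    exact Fin.ext (by omega)
  exact_mod_cast this

/-- A point mass selects a row, which is repeated in all rows of the product. -/
theorem pointMass_mul {n : ℕ} (x : Fin n) (A : Matrix (Fin n) (Fin n) ℝ) :
    pointMass n (x.val + 1) * A = Matrix.of fun _ y => A x y := by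
  ext i y
  simp [pointMass, Matrix.mul_apply, Fin.val_inj]

theorem pointMass_mul_transitionMatrix {n x : ℕ} (k : ℕ) (hx : 1 ≤ x) (hxn : x ≤ n) :
    pointMass n x * transitionMatrix n k = Matrix.of fun _ y => stepProb n k x (y.val + 1) := by
  have h := pointMass_mul ⟨x - 1, by omega⟩ (transitionMatrix n k)
  simp only [transitionMatrix, Matrix.of_apply, Nat.sub_add_cancel hx] at h
  exact h

theorem isLazy_transitionMatrix {n k : ℕ} (hk : 2 ≤ k) (hkn : k + 2 ≤ n) :
    IsLazy (transitionMatrix n k) := by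
  have hds := mem_doublyStochastic_iff_sum.1 (transitionMatrix_mem_doublyStochastic hk hkn)
  -- the diagonal entries of the transition matrix are at least `1 / 4`
  refine ⟨(4 / 3 : ℝ) • transitionMatrix n k - (1 / 3 : ℝ) • 1, ?_, by module⟩
  refine linfty_opNorm_le zero_le_one fun i => le_of_eq ?_
  have hnn : ∀ j, 0 ≤ ((4 / 3 : ℝ) • transitionMatrix n k - (1 / 3 : ℝ) • 1) i j := by
    intro j
    rw [Matrix.sub_apply, Matrix.smul_apply, Matrix.smul_apply, Matrix.one_apply, smul_eq_mul,
      smul_eq_mul]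
    by_cases hij : i = j
    · subst hij
      simp only [transitionMatrix, Matrix.of_apply, stepProb, or_true, if_true]
      split_ifs <;> first | omega | norm_num
    · have := hds.1 i j
      simp only [hij, if_false]
      linarith
  calc _ = ∑ j, ((4 / 3 : ℝ) * transitionMatrix n k i j - (1 / 3 : ℝ) * if i = j then 1 else 0) := by
        refine Finset.sum_congr rfl fun j _ => ?_
        rw [abs_of_nonneg (hnn j), Matrix.sub_apply, Matrix.smul_apply, Matrix.smul_apply,
          Matrix.one_apply, smul_eq_mul, smul_eq_mul]
    _ = 1 := by
        rw [Finset.sum_sub_distrib, ← Finset.mul_sum, ← Finset.mul_sum, hds.2.1 i]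
        simp; norm_num

theorem isCycleSystem_transitionMatrix {n k : ℕ} [Nonempty (Fin n)] (hk : 2 ≤ k)
    (hkn : k + 2 ≤ n) : IsCycleSystem (transitionMatrix n k) (pointMass n) n k where
  one_le := by omega
  lt := by omega
  isLazy := isLazy_transitionMatrix hk hkn
  norm_le := norm_pointMass_le n
  arc x hx hxn hxk := by
    rw [pointMass_mul_transitionMatrix k hx hxn.le]
    ext i y
    simp only [pointMass, stepProb, Matrix.of_apply, Matrix.add_apply, Matrix.smul_apply,
      smul_eq_mul]
    split_ifs <;> first | omega | norm_num
  hub_left := by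
    rw [pointMass_mul_transitionMatrix k (by omega) (by omega)]
    ext i y
    simp only [pointMass, stepProb, Matrix.of_apply, Matrix.add_apply, Matrix.smul_apply,
      smul_eq_mul]
    split_ifs <;> first | omega | norm_num
  hub_right := by
    rw [pointMass_mul_transitionMatrix k (by omega) le_rfl]
    ext i y
    simp only [pointMass, stepProb, Matrix.of_apply, Matrix.add_apply, Matrix.smul_apply,
      smul_eq_mul]
    split_ifs <;> first | omega | norm_num

/-- The matrix all of whose rows are the uniform distribution. -/
noncomputable def uniformMatrix (n : ℕ) : Matrix (Fin n) (Fin n) ℝ :=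
  Matrix.of fun _ _ => 1 / (n : ℝ)

theorem mul_uniformMatrix {n : ℕ} {A : Matrix (Fin n) (Fin n) ℝ}
    (hA : A ∈ doublyStochastic ℝ (Fin n)) : A * uniformMatrix n = uniformMatrix n := by
  ext i j
  simp [uniformMatrix, Matrix.mul_apply, ← Finset.sum_mul,
    (mem_doublyStochastic_iff_sum.1 hA).2.1 i]

theorem uniformMatrix_mul {n : ℕ} {A : Matrix (Fin n) (Fin n) ℝ}
    (hA : A ∈ doublyStochastic ℝ (Fin n)) : uniformMatrix n * A = uniformMatrix n := by
  ext i j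
  simp [uniformMatrix, Matrix.mul_apply, ← Finset.mul_sum,
    (mem_doublyStochastic_iff_sum.1 hA).2.2 j]

theorem sub_uniformMatrix_pow {n : ℕ} (hn : 0 < n) {A : Matrix (Fin n) (Fin n) ℝ}
    (hA : A ∈ doublyStochastic ℝ (Fin n)) {m : ℕ} (hm : 1 ≤ m) :
    (A - uniformMatrix n) ^ m = A ^ m - uniformMatrix n := by
  have hU : uniformMatrix n * uniformMatrix n = uniformMatrix n := by
    have hn' : (n : ℝ) ≠ 0 := by positivity
    ext i j
    simp [uniformMatrix, Matrix.mul_apply, hn']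
  induction m, hm using Nat.le_induction with
  | base => simp
  | succ m hm ih =>
    rw [pow_succ, ih, sub_mul, mul_sub, mul_sub, mul_uniformMatrix (pow_mem hA m),
      uniformMatrix_mul hA, hU, pow_succ]
    abel

/-- The uniform distribution is the mean of the rows of a doubly stochastic matrix. -/
theorem norm_sub_uniformMatrix_le {n : ℕ} (hn : 0 < n) {A : Matrix (Fin n) (Fin n) ℝ}
    (hA : A ∈ doublyStochastic ℝ (Fin n)) {c : ℝ} (hc : 0 ≤ c)
    (h : ∀ x, 1 ≤ x → x ≤ n → ‖pointMass n x * A - pointMass n 1 * A‖ ≤ c) :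
    ‖A - uniformMatrix n‖ ≤ 2 * c := by
  have hn' : (0 : ℝ) < n := by exact_mod_cast hn
  have hrow : ∀ x z : Fin n, ∑ y, |A x y - A z y| ≤ 2 * c := by
    intro x z
    have h1 := h (x.val + 1) (by omega) (by omega)
    have h2 := h (z.val + 1) (by omega) (by omega)
    have h3 := sum_abs_le_linfty_opNorm
      (pointMass n (x.val + 1) * A - pointMass n (z.val + 1) * A) x
    rw [pointMass_mul, pointMass_mul] at h3
    simp only [Matrix.sub_apply, Matrix.of_apply] at h3
    rw [← pointMass_mul, ← pointMass_mul] at h3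
    have h4 := norm_sub_le (pointMass n (x.val + 1) * A - pointMass n 1 * A)
      (pointMass n (z.val + 1) * A - pointMass n 1 * A)
    rw [sub_sub_sub_cancel_right] at h4
    linarith
  refine linfty_opNorm_le (by positivity) fun x => ?_
  have e : ∀ y, (A - uniformMatrix n) x y = (1 / (n : ℝ)) * ∑ z, (A x y - A z y) := by
    intro y
    rw [Finset.sum_sub_distrib, (mem_doublyStochastic_iff_sum.1 hA).2.2 y, Finset.sum_const,
      Finset.card_univ, Fintype.card_fin, nsmul_eq_mul, Matrix.sub_apply, uniformMatrix,
      Matrix.of_apply]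
    field_simp
  calc ∑ y, |(A - uniformMatrix n) x y|
      ≤ ∑ y, (1 / (n : ℝ)) * ∑ z, |A x y - A z y| := by
        refine Finset.sum_le_sum fun y _ => ?_
        rw [e, abs_mul, abs_of_pos (by positivity)]
        gcongr
        exact Finset.abs_sum_le_sum_abs _ _
    _ = (1 / (n : ℝ)) * ∑ z, ∑ y, |A x y - A z y| := by
        rw [← Finset.mul_sum, Finset.sum_comm]
    _ ≤ (1 / (n : ℝ)) * ∑ _z : Fin n, 2 * c := by
        gcongr with z
        exact hrow x z
    _ = 2 * c := by
        rw [Finset.sum_const, Finset.card_univ, Fintype.card_fin, nsmul_eq_mul]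
        field_simp

theorem maxDist_le_norm {n : ℕ} (hn : 0 < n) (k t : ℕ) :
    maxDist n k t ≤ 1 / 2 * ‖transitionMatrix n k ^ t - uniformMatrix n‖ := by
  have : Nonempty (Fin n) := ⟨⟨0, hn⟩⟩
  refine ciSup_le fun x => ?_
  unfold tvDist law
  gcongr
  exact sum_abs_le_linfty_opNorm (transitionMatrix n k ^ t - uniformMatrix n) x

/-- A number of steps that halves the distance to uniformity, for favourable `k` and with `L` about
`n ^ (1 / 4)`. -/
def halvingTime (n L : ℕ) : ℕ := 2 * (10 ^ 20 * L ^ 6) + 2 * n * (400 ^ 2 * L ^ 2)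

/-- With `L` about `n ^ (1 / 4)`, the `400 ^ 2 * L ^ 2` renewals make the delays by the arcs nearly
invisible, and the time `2 * 10 ^ 20 * L ^ 6` waited beforehand is so long that even the accumulated
passage errors stay small. -/
theorem error_le {n L : ℕ} (hL : 1 ≤ L) (hn : n ≤ 16 * L ^ 4) :
    IsCycleSystem.delayError n (10 ^ 20 * L ^ 6) (400 ^ 2 * L ^ 2) L (L + 1) (272 * L ^ 3) +
      IsCycleSystem.passageError n (10 ^ 20 * L ^ 6) ≤ 1 / 12 := by
  have hL' : (1 : ℝ) ≤ L := by exact_mod_cast hL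
  have hL0 : (0 : ℝ) < L := by linarith
  have hn' : (n : ℝ) ≤ 16 * L ^ 4 := by exact_mod_cast hn
  have hη : 3 / √(((2 * (10 ^ 20 * L ^ 6) : ℕ) : ℝ) + 1) ≤ 3 / (10 ^ 10 * (L : ℝ) ^ 3) := by
    gcongr
    refine Real.le_sqrt_of_sq_le ?_
    push_cast
    nlinarith [pow_pos hL0 6]
  have hN : (400 : ℝ) * L ≤ √(((400 ^ 2 * L ^ 2 : ℕ) : ℝ) + 1) := by
    refine Real.le_sqrt_of_sq_le ?_
    push_cast
    nlinarith
  have he : IsCycleSystem.passageError n (10 ^ 20 * L ^ 6) ≤ 13 / (10 ^ 10 * (L : ℝ) ^ 2) := by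
    unfold IsCycleSystem.passageError
    have h1 : (n : ℝ) * (9 / (((10 ^ 20 * L ^ 6 : ℕ) : ℝ) + 1)) ≤ 1 / (10 ^ 10 * (L : ℝ) ^ 2) := by
      calc (n : ℝ) * (9 / (((10 ^ 20 * L ^ 6 : ℕ) : ℝ) + 1))
          ≤ 16 * L ^ 4 * (9 / (10 ^ 20 * L ^ 6)) := by
            gcongr
            push_cast
            linarith
        _ = 144 / 10 ^ 10 * (1 / (10 ^ 10 * (L : ℝ) ^ 2)) := by field_simp; norm_num
        _ ≤ 1 * (1 / (10 ^ 10 * (L : ℝ) ^ 2)) := by gcongr; norm_num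
        _ = _ := one_mul _
    have h2 : 3 / (10 ^ 10 * (L : ℝ) ^ 3) ≤ 3 / (10 ^ 10 * (L : ℝ) ^ 2) := by
      gcongr
      norm_num
    have h3 : 13 / (10 ^ 10 * (L : ℝ) ^ 2) =
        1 / (10 ^ 10 * (L : ℝ) ^ 2) + 4 * (3 / (10 ^ 10 * (L : ℝ) ^ 2)) := by ring
    linarith
  have he' : 13 / (10 ^ 10 * (L : ℝ) ^ 2) ≤ 13 / 10 ^ 10 := by
    gcongr
    nlinarith
  have hs : 2 * ((272 * L ^ 3 : ℕ) : ℝ) * (3 / √(((2 * (10 ^ 20 * L ^ 6) : ℕ) : ℝ) + 1)) ≤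
      1632 / 10 ^ 10 := by
    calc _ ≤ 2 * ((272 * L ^ 3 : ℕ) : ℝ) * (3 / (10 ^ 10 * (L : ℝ) ^ 3)) := by gcongr
      _ = _ := by push_cast; field_simp; norm_num
  have hm : 8 * IsCycleSystem.passageError n (10 ^ 20 * L ^ 6) * ((400 ^ 2 * L ^ 2 : ℕ) : ℝ) ≤
      104 * 400 ^ 2 / 10 ^ 10 := by
    calc _ ≤ 8 * (13 / (10 ^ 10 * (L : ℝ) ^ 2)) * ((400 ^ 2 * L ^ 2 : ℕ) : ℝ) := by gcongr
      _ = _ := by push_cast; field_simp; norm_num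
  have hJ : (4 * (L : ℝ) + 8 * ((L + 1 : ℕ) : ℝ)) / √(((400 ^ 2 * L ^ 2 : ℕ) : ℝ) + 1) ≤
      20 / 400 := by
    calc _ ≤ (20 * (L : ℝ)) / (400 * L) := by
          gcongr
          push_cast
          linarith
      _ = _ := by field_simp
  unfold IsCycleSystem.delayError
  norm_num at hs hm hJ he he' ⊢
  linarith

theorem norm_pow_halvingTime_le {n k L : ℕ} (hk : 2 ≤ k) (hkn : k + 2 ≤ n) (hL : 1 ≤ L)
    (hLn : n ≤ 16 * L ^ 4) (h : IsBadlyApproximable n k L) :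
    ‖transitionMatrix n k ^ halvingTime n L - uniformMatrix n‖ ≤ 1 / 2 := by
  have : Nonempty (Fin n) := ⟨⟨0, by omega⟩⟩
  have hsys := isCycleSystem_transitionMatrix hk hkn
  have hs : 17 * n ≤ L * (272 * L ^ 3) := by
    calc 17 * n ≤ 17 * (16 * L ^ 4) := by gcongr
      _ = _ := by ring
  have herr := error_le hL hLn
  have hnear := fun D (hD : D ≤ n) =>
    h.exists_near_multiple (s := 272 * L ^ 3) (by omega) (by omega) hL hs hD
  refine (norm_sub_uniformMatrix_le (by omega)
    (pow_mem (transitionMatrix_mem_doublyStochastic hk hkn) _) (c := 1 / 4) (by norm_num)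
    fun x hx hxn => ?_).trans (by norm_num)
  exact (hsys.norm_sub_le_of_delay _ _ hnear hx hxn).trans (by linarith)

theorem maxDist_halvingTime_mul_le {n k L : ℕ} (hk : 2 ≤ k) (hkn : k + 2 ≤ n) (hL : 1 ≤ L)
    (hLn : n ≤ 16 * L ^ 4) (h : IsBadlyApproximable n k L) {m : ℕ} (hm : 1 ≤ m) :
    maxDist n k (halvingTime n L * m) ≤ (1 / 2) ^ m := by
  have : Nonempty (Fin n) := ⟨⟨0, by omega⟩⟩
  have h1 := norm_pow_halvingTime_le hk hkn hL hLn h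
  refine (maxDist_le_norm (by omega) k _).trans ?_
  rw [pow_mul, ← sub_uniformMatrix_pow (by omega)
    (pow_mem (transitionMatrix_mem_doublyStochastic hk hkn) _) hm]
  have h2 := (norm_pow_le (transitionMatrix n k ^ halvingTime n L - uniformMatrix n) m).trans
    (pow_le_pow_left₀ (norm_nonneg _) h1 m)
  have h3 : (0 : ℝ) ≤ (1 / 2) ^ m := by positivity
  linarith

end Matrix

/-! ### Mixing time and the choice of `k` -/

section MixingTime

theorem mixingTime_le {n k t : ℕ} {ε : ℝ} (h : maxDist n k t ≤ ε) : mixingTime n k ε ≤ t :=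
  iInf₂_le t h

theorem exists_fourth_root_bounds {n : ℕ} (hn : 1 ≤ n) :
    ∃ L : ℕ, 1 ≤ L ∧ L ^ 4 ≤ n ∧ n ≤ 16 * L ^ 4 := by
  have h1 := Nat.sqrt_le' n
  have h2 := Nat.lt_succ_sqrt' n
  have h3 := Nat.sqrt_le' n.sqrt
  have h4 := Nat.lt_succ_sqrt' n.sqrt
  have h5 : 1 ≤ n.sqrt := Nat.sqrt_pos.2 hn
  have h6 : 1 ≤ n.sqrt.sqrt := Nat.sqrt_pos.2 h5
  generalize n.sqrt.sqrt = L at *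
  generalize n.sqrt = s at *
  refine ⟨L, h6, ?_, ?_⟩
  · calc L ^ 4 = (L ^ 2) ^ 2 := by ring
      _ ≤ s ^ 2 := by gcongr
      _ ≤ n := h1
  · have h7 : s + 1 ≤ 4 * L ^ 2 := by
      calc s + 1 ≤ (L + 1) ^ 2 := h4
        _ ≤ (2 * L) ^ 2 := by gcongr; omega
        _ = _ := by ring
    calc n ≤ (s + 1) ^ 2 := h2.le
      _ ≤ (4 * L ^ 2) ^ 2 := by gcongr
      _ = _ := by ring

theorem halvingTime_le {n L : ℕ} (hL : L ^ 4 ≤ n) :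
    (halvingTime n L : ℝ) ≤ 10 ^ 21 * (n : ℝ) ^ (3 / 2 : ℝ) := by
  have hn0 : (0 : ℝ) ≤ n := Nat.cast_nonneg n
  have hL' : (L : ℝ) ^ 4 ≤ n := by exact_mod_cast hL
  have hs : (L : ℝ) ^ 2 ≤ √n := Real.le_sqrt_of_sq_le (by rw [← pow_mul]; exact hL')
  have hp : (n : ℝ) ^ (3 / 2 : ℝ) = n * √n := by
    rw [show (3 / 2 : ℝ) = 1 + 1 / 2 by norm_num, Real.rpow_add' hn0 (by norm_num), Real.rpow_one,
      Real.sqrt_eq_rpow]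
  have h6 : (L : ℝ) ^ 6 ≤ n * √n := by
    calc (L : ℝ) ^ 6 = L ^ 4 * L ^ 2 := by ring
      _ ≤ n * √n := by gcongr
  have h2 : (n : ℝ) * L ^ 2 ≤ n * √n := by gcongr
  have h0 : (0 : ℝ) ≤ n * √n := by positivity
  rw [hp]
  unfold halvingTime
  push_cast
  linarith

theorem exists_pow_half_le {ε : ℝ} (hε : 0 < ε) (hε2 : ε < 1 / 2) :
    ∃ m : ℕ, 1 ≤ m ∧ (1 / 2 : ℝ) ^ m ≤ ε ∧ (m : ℝ) ≤ 2 / Real.log 2 * Real.log (1 / ε) := by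
  have hl2 : 0 < Real.log 2 := Real.log_pos one_lt_two
  have h1 : Real.log 2 ≤ Real.log (1 / ε) := by
    refine Real.log_le_log two_pos ?_
    rw [le_div_iff₀ hε]
    linarith
  have hx : 1 ≤ Real.log (1 / ε) / Real.log 2 := (one_le_div hl2).2 h1
  refine ⟨⌈Real.log (1 / ε) / Real.log 2⌉₊, Nat.one_le_ceil_iff.2 (by linarith), ?_, ?_⟩
  · have h2 := Nat.le_ceil (Real.log (1 / ε) / Real.log 2)
    rw [div_le_iff₀ hl2, ← Real.log_pow] at h2
    have h3 := (Real.log_le_log_iff (by positivity) (by positivity)).1 h2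
    rw [div_pow, one_pow]
    exact (one_div_le hε (by positivity)).1 h3
  · have h2 := (Nat.ceil_lt_add_one (by linarith : 0 ≤ Real.log (1 / ε) / Real.log 2)).le
    calc _ ≤ Real.log (1 / ε) / Real.log 2 + 1 := h2
      _ ≤ 2 * (Real.log (1 / ε) / Real.log 2) := by linarith
      _ = _ := by ring

theorem half_le_uniformOn_real {n : ℕ} (hn : 16 ≤ n) {F : Finset ℕ} {S : Set ℕ}
    (hF : F ⊆ Finset.Icc 2 (n - 2)) (hFS : ∀ k ∈ F, k ∈ S) (hcard : n ≤ 2 * F.card) :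
    1 / 2 ≤ (uniformOn (Set.Icc 2 (n - 2))).real S := by
  have hprob : MeasureTheory.IsProbabilityMeasure (uniformOn (Set.Icc 2 (n - 2))) :=
    isProbabilityMeasure_uniformOn (Set.finite_Icc _ _) ⟨2, Set.mem_Icc.2 ⟨le_rfl, by omega⟩⟩
  refine le_trans ?_ (MeasureTheory.measureReal_mono (s₁ := (F : Set ℕ)) fun k hk => hFS k hk)
  rw [MeasureTheory.measureReal_def, ← Finset.coe_Icc, uniformOn_apply_finset,
    Finset.inter_eq_right.2 hF, Nat.card_Icc, ENNReal.toReal_div, ENNReal.toReal_natCast,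
    ENNReal.toReal_natCast, div_le_div_iff₀ two_pos (by norm_cast; omega)]
  norm_cast
  omega

end MixingTime

end DriftedCycle

open DriftedCycle in
theorem theorem1 :
    ∃ γ γ' : ℝ, 0 < γ ∧ 0 < γ' ∧
      ∀ ε : ℝ, 0 < ε → ε < 1 / 2 →
        ∀ᶠ n : ℕ in atTop,
          γ ≤ (uniformOn (Set.Icc 2 (n - 2))).real
            {k : ℕ | (DriftedCycle.mixingTime n k ε : ℝ≥0∞) ≤
              ENNReal.ofReal (γ' * (n : ℝ) ^ (3 / 2 : ℝ) * Real.log (1 / ε))} := by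
  classical
  have hl2 : 0 < Real.log 2 := Real.log_pos one_lt_two
  refine ⟨1 / 2, 10 ^ 21 * (2 / Real.log 2), by norm_num, by positivity, fun ε hε hε2 => ?_⟩
  obtain ⟨m, hm1, hmε, hm⟩ := exists_pow_half_le hε hε2
  filter_upwards [eventually_ge_atTop 16] with n hn
  obtain ⟨L, hL1, hL4, hn4⟩ := exists_fourth_root_bounds (show 1 ≤ n by omega)
  have hL2 : L ^ 2 ≤ n := (Nat.pow_le_pow_right hL1 (by norm_num)).trans hL4
  refine half_le_uniformOn_real hn (Finset.filter_subset _ _) (fun k hk => ?_)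
    (half_le_card_isBadlyApproximable hn hL1 hL2)
  obtain ⟨hk1, hk2⟩ := Finset.mem_filter.1 hk
  rw [Finset.mem_Icc] at hk1
  have hmix : mixingTime n k ε ≤ ((halvingTime n L * m : ℕ) : ℕ∞) :=
    mixingTime_le ((maxDist_halvingTime_mul_le hk1.1 (by omega) hL1 hn4 hk2 hm1).trans hmε)
  calc (mixingTime n k ε : ℝ≥0∞) ≤ (((halvingTime n L * m : ℕ) : ℕ∞) : ℝ≥0∞) :=
        ENat.toENNReal_le.2 hmix
    _ = ENNReal.ofReal ((halvingTime n L * m : ℕ) : ℝ) := by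
        rw [ENat.toENNReal_coe, ENNReal.ofReal_natCast]
    _ ≤ _ := by
        refine ENNReal.ofReal_le_ofReal ?_
        push_cast
        calc (halvingTime n L : ℝ) * m
            ≤ (10 ^ 21 * (n : ℝ) ^ (3 / 2 : ℝ)) * (2 / Real.log 2 * Real.log (1 / ε)) := by
              gcongr
              exact halvingTime_le hL4
          _ = _ := by ring
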